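/- Consider Minkowski space-time with inertial coordinates $(t,x,y,z)$, metric of signature $(-,+,+,+)$, and $r=\sqrt{x^2+y^2+z^2}$. Let $U$ be a non-empty connected open subset and let $u$ be a smooth radial unit time-like vector field on $U$, that is, $u=\cosh\phi\,\partial_t+\sinh\phi\,\partial_r$ for a function $\phi$ on $U$ (equivalently $-\cosh\phi\,\mathrm{d}t+\sinh\phi\,\mathrm{d}r$ as a covector), with $u=\partial_t$ and $\phi=0$ at points of $U$ where $r=0$. Write $a=\nabla_u u$ for the acceleration and $\theta=\nabla\cdot u$ for the expansion of $u$. Say that $u$ is the velocity of a classical ideal gas (CIG) on $U$ if there are constants $k>0$, $c_v>0$ and smooth functions $\rho,p,n,\epsilon,s,\Theta$ on $U$ (energy density, pressure, matter density, specific internal energy, specific entropy, temperature) with $n>0$ such that $$\nabla\cdot\big((\rho+p)\,u\otimes u+p\,g\big)=0,\quad \rho=n(1+\epsilon),\quad \nabla\cdot(nu)=0,\quad \Theta\,\mathrm{d}s=\mathrm{d}\epsilon+p\,\mathrm{d}(1/n),\quad p=kn\Theta>0,\quad \epsilon=c_v\Theta .$$ Then the following are equivalent: 1. $u$ is geodesic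 ($a=0$ on $U$), expanding ($\theta\neq 0$ at every point of $U$), and the velocity of a CIG on $U$; 2. $u$ is a Milne congruence: there is a constant $t_0\in\mathbb{R}$ such that $t\neq t_0$ on $U$ and $\tanh\phi=\dfrac{r}{t-t_0}$ on $U$. -/

import Mathlib

open scoped ContDiff

namespace Minkowski

/-- Events of Minkowski space-time in inertial coordinates `(t, x, y, z)`; index `0` is time.
Vector fields are given by their contravariant components in these coordinates, in which the
covariant derivative is the partial derivative. -/
abbrev Event : Type := Fin 4 → ℝ

/-- The Minkowski metric of signature `(-,+,+,+)`, in inertial coordinates. The inverse metric has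
the same components. -/
def eta : Matrix (Fin 4) (Fin 4) ℝ := Matrix.diagonal ![-1, 1, 1, 1]

/-- The radial coordinate `r` of an event. -/
noncomputable def radius (x : Event) : ℝ := Real.sqrt (x 1 ^ 2 + x 2 ^ 2 + x 3 ^ 2)

/-- The inertial time direction `∂/∂t`. -/
def timeDir : Event := ![1, 0, 0, 0]

/-- The unit radial direction `∂/∂r` at an event off the axis `r = 0` (the zero vector on it). -/
noncomputable def radialDir (x : Event) : Event :=
  ![0, x 1 / radius x, x 2 / radius x, x 3 / radius x]

/-- The partial derivative `∂_i f` at `x`. -/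
noncomputable def pderiv (i : Fin 4) (f : Event → ℝ) (x : Event) : ℝ :=
  fderiv ℝ f x (Pi.single i 1)

/-- The divergence `∇ · X` of a vector field. -/
noncomputable def divergence (X : Event → Event) (x : Event) : ℝ :=
  ∑ i, pderiv i (fun y => X y i) x

/-- The acceleration `a = ∇_u u` of `u`. -/
noncomputable def acceleration (u : Event → Event) (x : Event) : Event :=
  fderiv ℝ u x (u x)

/-- The expansion `θ = ∇ · u` of `u`. -/
noncomputable def expansion (u : Event → Event) (x : Event) : ℝ := divergence u x

/-- The congruence of `u` is geodesic on `U`. -/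
def IsGeodesic (U : Set Event) (u : Event → Event) : Prop :=
  ∀ x ∈ U, acceleration u x = 0

/-- The congruence of `u` is expanding on `U`: its expansion vanishes nowhere. -/
def IsExpanding (U : Set Event) (u : Event → Event) : Prop :=
  ∀ x ∈ U, expansion u x ≠ 0

/-- `u` is a radial unit time-like vector field on `U` with hyperbolic angle `φ`:
`u = cosh φ ∂/∂t + sinh φ ∂/∂r`, that is, `- cosh φ dt + sinh φ dr` as a covector; where the axis
`r = 0` meets `U`, there is no radial direction and `u = ∂/∂t`, `φ = 0`. -/
def IsRadialUnit (U : Set Event) (u : Event → Event) (φ : Event → ℝ) : Prop :=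
  ∀ x ∈ U, u x = Real.cosh (φ x) • timeDir + Real.sinh (φ x) • radialDir x ∧
    (radius x = 0 → φ x = 0)

/-- The contravariant components of the perfect fluid energy tensor
`T = (ρ + p) u ⊗ u + p g`. -/
noncomputable def energyTensor (u : Event → Event) (ρ p : Event → ℝ) (x : Event)
    (i j : Fin 4) : ℝ :=
  (ρ x + p x) * u x i * u x j + p x * eta i j

/-- The fundamental system of the hydrodynamics of a classical ideal gas on `U`, for a gas with
constants `k = k_B / m` and heat capacity `c_v`: the unit velocity is `u`, the energy density `ρ`,
the pressure `p`, the matter density `n`, the specific internal energy `ε`, the specific entropy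
`s` and the temperature `Θ`. -/
structure IsCIGSolution (U : Set Event) (k c_v : ℝ) (u : Event → Event)
    (ρ p n ε s Θ : Event → ℝ) : Prop where
  smooth_ρ : ContDiffOn ℝ ∞ ρ U
  smooth_p : ContDiffOn ℝ ∞ p U
  smooth_n : ContDiffOn ℝ ∞ n U
  smooth_ε : ContDiffOn ℝ ∞ ε U
  smooth_s : ContDiffOn ℝ ∞ s U
  smooth_Θ : ContDiffOn ℝ ∞ Θ U
  /-- Conservation of energy and momentum, `∇ · T = 0`. -/
  conservation : ∀ x ∈ U, ∀ j, ∑ i, pderiv i (fun y => energyTensor u ρ p y i j) x = 0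
  /-- The matter density is positive. -/
  n_pos : ∀ x ∈ U, 0 < n x
  /-- `ρ = n (1 + ε)`. -/
  energy_eq : ∀ x ∈ U, ρ x = n x * (1 + ε x)
  /-- Conservation of matter, `∇ · (n u) = 0`. -/
  matter : ∀ x ∈ U, divergence (fun y => n y • u y) x = 0
  /-- Local thermal equilibrium, `Θ ds = dε + p d(1/n)`. -/
  lte : ∀ x ∈ U,
    Θ x • fderiv ℝ s x = fderiv ℝ ε x + p x • fderiv ℝ (fun y => 1 / n y) x
  /-- Equation of state `p = k n Θ > 0`. -/
  p_eq : ∀ x ∈ U, p x = k * n x * Θ x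
  p_pos : ∀ x ∈ U, 0 < p x
  /-- Equation of state `ε = c_v Θ`. -/
  ε_eq : ∀ x ∈ U, ε x = c_v * Θ x

/-- `u` is on `U` the velocity of some classical ideal gas. -/
def IsCIGFlow (U : Set Event) (u : Event → Event) : Prop :=
  ∃ k c_v : ℝ, 0 < k ∧ 0 < c_v ∧
    ∃ ρ p n ε s Θ : Event → ℝ, IsCIGSolution U k c_v u ρ p n ε s Θ

/-- The radial field of hyperbolic angle `φ` is on `U` a Milne congruence:
`tanh φ = r / (t - t₀)` for a constant `t₀`. -/
def IsMilne (U : Set Event) (φ : Event → ℝ) : Prop :=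
  ∃ t₀ : ℝ, ∀ x ∈ U, x 0 ≠ t₀ ∧ Real.tanh (φ x) = radius x / (x 0 - t₀)

end Minkowski

namespace Minkowski

/-! ### Partial derivatives -/

section UnitGeodesic

variable {U : Set Event} {u : Event → Event} {f g : Event → ℝ} {x : Event}

/-! From the gas to Milne. For a geodesic flow, the momentum equation makes `∂p` parallel to `u`.
With `γ = k / c_v + 1`, energy and matter conservation give `∂_j p = γ p θ u_j`, so `θ u` is the
gradient of `γ⁻¹ log p` (`IsCIGFlow.exists_potential`). The engine is
`IsGeodesic.pderiv_eq_of_gradient`: if `g u` is a gradient and `u` is unit and geodesic, then `∂g`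
is again parallel to `u`. With `g = θ ≠ 0` it also yields irrotationality. Raychaudhuri's equation
then reads `∂θ = tr((∇u)²) u`, and the engine applied once more shows that `tr((∇u)²)` too is
constant orthogonally to `u`. Off the axis write `u^i = v x^i`. The matrix `∇u` has eigenvalues `0,
v, v, θ - 2v`, so `θ` and `2v² + (θ - 2v)²` are both constant along the direction orthogonal to `u`
in the `(t, r)` plane. Differentiating gives `(θ - 3v) ∂_⊥ v = 0`, while geometry gives `∂_⊥ v`
proportional to `θ - 3v` with non-zero factor. Hence `θ = 3v`, and `t - 3u⁰/θ` has zero gradient;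
its value on the connected set `U` is `t₀`. Conversely, a Milne field is `v` times the position
relative to `(t₀, 0, 0, 0)`, with `v² = 1/τ²` for the proper time `τ` from that event. It carries an
explicit isentropic gas with temperature `1/|τ|`. -/

theorem pderiv_mul (i : Fin 4) (hf : DifferentiableAt ℝ f x) (hg : DifferentiableAt ℝ g x) :
    pderiv i (fun y => f y * g y) x = pderiv i f x * g x + f x * pderiv i g x := by
  simp only [pderiv, fderiv_fun_mul hf hg, add_apply, smul_apply, smul_eq_mul]
  ring

theorem pderiv_add (i : Fin 4) (hf : DifferentiableAt ℝ f x) (hg : DifferentiableAt ℝ g x) :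
    pderiv i (fun y => f y + g y) x = pderiv i f x + pderiv i g x := by
  simp [pderiv, fderiv_fun_add hf hg]

theorem pderiv_sub (i : Fin 4) (hf : DifferentiableAt ℝ f x) (hg : DifferentiableAt ℝ g x) :
    pderiv i (fun y => f y - g y) x = pderiv i f x - pderiv i g x := by
  simp [pderiv, fderiv_fun_sub hf hg]

theorem pderiv_const (i : Fin 4) (c : ℝ) : pderiv i (fun _ => c) x = 0 := by
  simp [pderiv]

theorem pderiv_const_mul (i : Fin 4) (c : ℝ) (hf : DifferentiableAt ℝ f x) :
    pderiv i (fun y => c * f y) x = c * pderiv i f x := by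
  rw [pderiv_mul i (differentiableAt_const c) hf, pderiv_const]; ring

theorem pderiv_pow (i : Fin 4) (n : ℕ) (hf : DifferentiableAt ℝ f x) :
    pderiv i (fun y => f y ^ n) x = n * f x ^ (n - 1) * pderiv i f x := by
  simp [pderiv, fderiv_fun_pow n hf]

theorem pderiv_sum {ι : Type*} (s : Finset ι) {F : ι → Event → ℝ} (i : Fin 4)
    (hF : ∀ j ∈ s, DifferentiableAt ℝ (F j) x) :
    pderiv i (fun y => ∑ j ∈ s, F j y) x = ∑ j ∈ s, pderiv i (F j) x := by
  simp [pderiv, fderiv_fun_sum hF]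

theorem differentiableAt_coord (j : Fin 4) : DifferentiableAt ℝ (fun y : Event => y j) x := by
  fun_prop

theorem pderiv_coord (i j : Fin 4) :
    pderiv i (fun y => y j) x = if i = j then 1 else 0 := by
  have h : fderiv ℝ (fun y : Event => y j) x = ContinuousLinearMap.proj j :=
    (ContinuousLinearMap.proj (R := ℝ) (φ := fun _ : Fin 4 => ℝ) j).fderiv
  simp [pderiv, h, Pi.single_apply, eq_comm]

theorem pderiv_congr (hU : IsOpen U) (hx : x ∈ U) (h : ∀ y ∈ U, f y = g y) (i : Fin 4) :
    pderiv i f x = pderiv i g x := by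
  have : f =ᶠ[nhds x] g := Filter.eventually_of_mem (hU.mem_nhds hx) h
  simp [pderiv, this.fderiv_eq]

theorem fderiv_apply_eq_sum (f : Event → ℝ) (x w : Event) :
    fderiv ℝ f x w = ∑ i, w i * pderiv i f x := by
  conv_lhs => rw [← Finset.univ_sum_single w]
  rw [map_sum]
  refine Finset.sum_congr rfl fun i _ => ?_
  have : Pi.single i (w i) = w i • (Pi.single i 1 : Event) := by
    rw [← Pi.single_smul]; simp
  simp [this, pderiv]

theorem fderiv_eq_zero_of_pderiv (h : ∀ i, pderiv i f x = 0) : fderiv ℝ f x = 0 := by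
  ext1 w
  simp [fderiv_apply_eq_sum, h]

theorem differentiableAt_of_contDiffOn (hf : ContDiffOn ℝ ∞ f U) (hU : IsOpen U)
    (hx : x ∈ U) : DifferentiableAt ℝ f x :=
  (hf.contDiffAt (hU.mem_nhds hx)).differentiableAt (by simp)

theorem contDiffOn_pderiv (hU : IsOpen U) (hf : ContDiffOn ℝ ∞ f U) (i : Fin 4) :
    ContDiffOn ℝ ∞ (pderiv i f) U :=
  (hf.fderiv_of_isOpen hU (m := ∞) (by simp)).clm_apply contDiffOn_const

theorem contDiffOn_component (hu : ContDiffOn ℝ ∞ u U) (j : Fin 4) :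
    ContDiffOn ℝ ∞ (fun y => u y j) U :=
  contDiffOn_pi.1 hu j

theorem pderiv_comm (hU : IsOpen U) (hf : ContDiffOn ℝ ∞ f U) (hx : x ∈ U) (i j : Fin 4) :
    pderiv i (pderiv j f) x = pderiv j (pderiv i f) x := by
  have hfx := hf.contDiffAt (hU.mem_nhds hx)
  have hs : IsSymmSndFDerivAt ℝ f x := hfx.isSymmSndFDerivAt (by simpa using by norm_cast)
  have hd : DifferentiableAt ℝ (fderiv ℝ f) x :=
    (hfx.fderiv_right (m := 1) (by norm_cast)).differentiableAt (by simp)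
  have key : ∀ a b : Fin 4, pderiv a (pderiv b f) x
      = fderiv ℝ (fderiv ℝ f) x (Pi.single a 1) (Pi.single b 1) := by
    intro a b
    have h : pderiv a (pderiv b f) x = _ :=
      congrArg (fun L => L (Pi.single a 1))
        (fderiv_clm_apply hd (differentiableAt_const (Pi.single b 1 : Event)))
    rw [h]
    simp
  rw [key, key, hs]

theorem acceleration_apply (hu : DifferentiableAt ℝ u x) (j : Fin 4) :
    acceleration u x j = ∑ i, u x i * pderiv i (fun y => u y j) x := by
  rw [← fderiv_apply_eq_sum, acceleration]
  have h : HasFDerivAt (fun y => u y j) _ x := hasFDerivAt_pi'.1 hu.hasFDerivAt j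
  rw [h.fderiv]; rfl

/-! ### Unit geodesic fields -/

/-- The covariant components of a vector. -/
def lower (w : Event) (j : Fin 4) : ℝ := eta j j * w j

theorem eta_self_sq (j : Fin 4) : eta j j * eta j j = 1 := by
  fin_cases j <;> simp [eta]

theorem lower_zero (w : Event) : lower w 0 = -w 0 := by simp [lower, eta]
theorem lower_one (w : Event) : lower w 1 = w 1 := by simp [lower, eta]
theorem lower_two (w : Event) : lower w 2 = w 2 := by simp [lower, eta]
theorem lower_three (w : Event) : lower w 3 = w 3 := by simp [lower, eta]

/-- A unit time-like vector field. -/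
def IsUnitTimelike (U : Set Event) (u : Event → Event) : Prop :=
  ∀ x ∈ U, ∑ i, lower (u x) i * u x i = -1

/-- The derivative of `f` along the field `u`. -/
noncomputable def along (u : Event → Event) (f : Event → ℝ) (x : Event) : ℝ :=
  ∑ i, u x i * pderiv i f x

theorem contDiffOn_expansion (hU : IsOpen U) (hu : ContDiffOn ℝ ∞ u U) :
    ContDiffOn ℝ ∞ (expansion u) U := by
  unfold expansion divergence
  exact ContDiffOn.sum fun i _ => contDiffOn_pderiv hU (contDiffOn_component hu i) i

theorem contDiffOn_lower (hu : ContDiffOn ℝ ∞ u U) (j : Fin 4) :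
    ContDiffOn ℝ ∞ (fun y => lower (u y) j) U :=
  contDiffOn_const.mul (contDiffOn_component hu j)

theorem pderiv_lower (hu : ContDiffOn ℝ ∞ u U) (hU : IsOpen U) (hx : x ∈ U) (i j : Fin 4) :
    pderiv i (fun y => lower (u y) j) x = eta j j * pderiv i (fun y => u y j) x :=
  pderiv_const_mul i _ (differentiableAt_of_contDiffOn (contDiffOn_component hu j) hU hx)

theorem IsUnitTimelike.sum_lower_mul_pderiv (hun : IsUnitTimelike U u) (hU : IsOpen U) (hu : ContDiffOn ℝ ∞ u U)
    (hx : x ∈ U) (j : Fin 4) : ∑ i, lower (u x) i * pderiv j (fun y => u y i) x = 0 := by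
  have hd : ∀ i, DifferentiableAt ℝ (fun y => u y i) x := fun i =>
    differentiableAt_of_contDiffOn (contDiffOn_component hu i) hU hx
  have hl : ∀ i, DifferentiableAt ℝ (fun y => lower (u y) i) x := fun i =>
    differentiableAt_of_contDiffOn (contDiffOn_lower hu i) hU hx
  have h := pderiv_congr hU hx hun j
  rw [pderiv_const, pderiv_sum _ _ fun i _ => (hl i).fun_mul (hd i)] at h
  have h2 : ∑ i, (lower (u x) i * pderiv j (fun y => u y i) x
      + lower (u x) i * pderiv j (fun y => u y i) x) = 0 := by
    rw [← h]
    refine Finset.sum_congr rfl fun i _ => ?_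
    rw [pderiv_mul j (hl i) (hd i), pderiv_lower hu hU hx, lower]
    ring
  rw [Finset.sum_add_distrib] at h2
  linarith

theorem IsGeodesic.sum_mul_pderiv (hgeo : IsGeodesic U u) (hU : IsOpen U)
    (hu : ContDiffOn ℝ ∞ u U) (hx : x ∈ U) (j : Fin 4) :
    ∑ i, u x i * pderiv i (fun y => u y j) x = 0 := by
  rw [← acceleration_apply ((hu.contDiffAt (hU.mem_nhds hx)).differentiableAt (by simp)),
    hgeo x hx]; rfl

/-- The Hessian of `f` is symmetric, in terms of its gradient. -/
theorem gradient_closed (hU : IsOpen U) (hf : ContDiffOn ℝ ∞ f U)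
    (hg : ContDiffOn ℝ ∞ g U) (hu : ContDiffOn ℝ ∞ u U)
    (hfg : ∀ y ∈ U, ∀ j, pderiv j f y = g y * lower (u y) j) (hx : x ∈ U) (i j : Fin 4) :
    pderiv i g x * lower (u x) j + g x * (eta j j * pderiv i (fun y => u y j) x)
      = pderiv j g x * lower (u x) i + g x * (eta i i * pderiv j (fun y => u y i) x) := by
  have h := pderiv_comm hU hf hx i j
  rw [pderiv_congr hU hx (fun y hy => hfg y hy j), pderiv_congr hU hx (fun y hy => hfg y hy i),
    pderiv_mul, pderiv_mul, pderiv_lower hu hU hx, pderiv_lower hu hU hx] at h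
  · exact h
  all_goals first
    | exact differentiableAt_of_contDiffOn hg hU hx
    | exact differentiableAt_of_contDiffOn (contDiffOn_lower hu _) hU hx

/-- If the gradient of `f` is `g u`, then the gradient of `g` is parallel to `u` as well. -/
theorem IsGeodesic.pderiv_eq_of_gradient (hgeo : IsGeodesic U u) (hun : IsUnitTimelike U u)
    (hU : IsOpen U) (hu : ContDiffOn ℝ ∞ u U) (hf : ContDiffOn ℝ ∞ f U)
    (hg : ContDiffOn ℝ ∞ g U)
    (hfg : ∀ y ∈ U, ∀ j, pderiv j f y = g y * lower (u y) j) (hx : x ∈ U) (j : Fin 4) :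
    pderiv j g x = -along u g x * lower (u x) j := by
  -- The symmetric Hessian is contracted with `u^i`: the terms in `g` die by geodesy and by unit
  -- norm, and `u^i u_i = -1` isolates `∂_j g`.
  have hc := fun i => gradient_closed hU hf hg hu hfg hx i j
  have ha := hgeo.sum_mul_pderiv hU hu hx j
  have hb := hun.sum_lower_mul_pderiv hU hu hx j
  have h1 := hun x hx
  simp only [along, Fin.sum_univ_four] at *
  have h0 := hc 0
  have h2 := hc 1
  have h3 := hc 2
  have h4 := hc 3
  simp only [lower] at *
  linear_combination u x 0 * h0 + u x 1 * h2 + u x 2 * h3 + u x 3 * h4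
    - g x * eta j j * ha + g x * hb + pderiv j g x * h1

/-- If `θ u` is a gradient and `θ` vanishes nowhere, then `u` is irrotational. -/
theorem IsGeodesic.pderiv_lower_symm (hgeo : IsGeodesic U u) (hun : IsUnitTimelike U u)
    (hU : IsOpen U) (hu : ContDiffOn ℝ ∞ u U) (hf : ContDiffOn ℝ ∞ f U)
    (hg : ContDiffOn ℝ ∞ g U) (hfg : ∀ y ∈ U, ∀ j, pderiv j f y = g y * lower (u y) j)
    (hx : x ∈ U) (hgx : g x ≠ 0) (i j : Fin 4) :
    eta j j * pderiv i (fun y => u y j) x = eta i i * pderiv j (fun y => u y i) x := by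
  have hc := gradient_closed hU hf hg hu hfg hx i j
  rw [hgeo.pderiv_eq_of_gradient hun hU hu hf hg hfg hx i,
    hgeo.pderiv_eq_of_gradient hun hU hu hf hg hfg hx j] at hc
  refine mul_left_cancel₀ hgx ?_
  linear_combination hc

/-- The trace of the square of the velocity gradient. -/
noncomputable def gradSq (u : Event → Event) (x : Event) : ℝ :=
  ∑ i, ∑ j, pderiv i (fun y => u y j) x * pderiv j (fun y => u y i) x

theorem contDiffOn_gradSq (hU : IsOpen U) (hu : ContDiffOn ℝ ∞ u U) :
    ContDiffOn ℝ ∞ (gradSq u) U :=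
  ContDiffOn.sum fun i _ => ContDiffOn.sum fun j _ =>
    (contDiffOn_pderiv hU (contDiffOn_component hu j) i).mul
      (contDiffOn_pderiv hU (contDiffOn_component hu i) j)

/-- The Raychaudhuri equation in flat space-time. -/
theorem IsGeodesic.along_expansion (hgeo : IsGeodesic U u) (hU : IsOpen U)
    (hu : ContDiffOn ℝ ∞ u U) (hx : x ∈ U) :
    along u (expansion u) x = -gradSq u x := by
  have hd : ∀ i, DifferentiableAt ℝ (fun y => u y i) x := fun i =>
    differentiableAt_of_contDiffOn (contDiffOn_component hu i) hU hx
  have hdd : ∀ i j, DifferentiableAt ℝ (fun y => pderiv j (fun z => u z i) y) x := fun i j =>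
    differentiableAt_of_contDiffOn (contDiffOn_pderiv hU (contDiffOn_component hu i) j) hU hx
  -- Apply `∂_j` to the `j`-th geodesic equation. Summing over `j` and commuting partials, which is
  -- where flatness enters, turns the second-order terms into `u·∂θ`.
  have h1 : ∀ j, ∑ i, (pderiv j (fun y => u y i) x * pderiv i (fun y => u y j) x
      + u x i * pderiv i (pderiv j (fun y => u y j)) x) = 0 := by
    intro j
    have h := pderiv_congr hU hx (fun y hy => hgeo.sum_mul_pderiv hU hu hy j) j
    rw [pderiv_const, pderiv_sum _ _ fun i _ => (hd i).fun_mul (hdd j i)] at h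
    rw [← h]
    refine Finset.sum_congr rfl fun i _ => ?_
    rw [pderiv_mul j (hd i) (hdd j i), pderiv_comm hU (contDiffOn_component hu j) hx i j]
  have h2 : ∀ i, pderiv i (expansion u) x = ∑ j, pderiv i (pderiv j (fun y => u y j)) x :=
    fun i => pderiv_sum Finset.univ i fun j _ => hdd j j
  have h3 : ∑ j, ∑ i, (pderiv j (fun y => u y i) x * pderiv i (fun y => u y j) x
      + u x i * pderiv i (pderiv j (fun y => u y j)) x) = 0 :=
    Finset.sum_eq_zero fun j _ => h1 j
  simp only [Finset.sum_add_distrib] at h3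
  rw [Finset.sum_comm (f := fun j i => u x i * pderiv i (pderiv j (fun y => u y j)) x)] at h3
  simp only [along, h2, gradSq, Finset.mul_sum]
  linarith

/-- The divergence of a perfect fluid energy tensor. -/
theorem divergence_energyTensor {F p : Event → ℝ} (hu : DifferentiableAt ℝ u x)
    (hF : DifferentiableAt ℝ F x) (hp : DifferentiableAt ℝ p x) (j : Fin 4) :
    ∑ i, pderiv i (fun y => F y * u y i * u y j + p y * eta i j) x
      = (along u F x + F x * expansion u x) * u x j + F x * acceleration u x j
        + eta j j * pderiv j p x := by
  have hd : ∀ i, DifferentiableAt ℝ (fun y => u y i) x := fun i => differentiableAt_pi.1 hu i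
  have h1 : ∀ i, pderiv i (fun y => F y * u y i * u y j + p y * eta i j) x
      = (u x i * pderiv i F x + F x * pderiv i (fun y => u y i) x) * u x j
        + F x * (u x i * pderiv i (fun y => u y j) x) + pderiv i p x * eta i j := by
    intro i
    rw [pderiv_add i ((hF.fun_mul (hd i)).fun_mul (hd j)) (hp.fun_mul (differentiableAt_const _)),
      pderiv_mul i (hF.fun_mul (hd i)) (hd j), pderiv_mul i hF (hd i),
      pderiv_mul i hp (differentiableAt_const _), pderiv_const]
    ring
  have h2 : ∑ i, pderiv i p x * eta i j = eta j j * pderiv j p x := by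
    rw [Finset.sum_eq_single j]
    · ring
    · intro i _ hij; simp [eta, hij]
    · simp
  simp only [h1, Finset.sum_add_distrib, h2, ← Finset.sum_mul, ← Finset.mul_sum,
    acceleration_apply hu, along, expansion, divergence]

end UnitGeodesic

section Radial

/-! ### Radial geodesic fields -/

variable {U : Set Event} {u : Event → Event} {f g v : Event → ℝ} {x : Event}

/-- The spatial components of `u` are `v` times the position. -/
def IsRadialWith (U : Set Event) (u : Event → Event) (v : Event → ℝ) : Prop :=
  ∀ y ∈ U, u y 1 = v y * y 1 ∧ u y 2 = v y * y 2 ∧ u y 3 = v y * y 3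

theorem pderiv_mul_coord (hv : DifferentiableAt ℝ v x) (i j : Fin 4) :
    pderiv i (fun y => v y * y j) x = pderiv i v x * x j + if i = j then v x else 0 := by
  rw [pderiv_mul i hv (differentiableAt_coord j), pderiv_coord]
  simp

theorem IsRadialWith.pderiv_component (hr : IsRadialWith U u v) (hU : IsOpen U)
    (hv : ContDiffOn ℝ ∞ v U) (hx : x ∈ U) (i : Fin 4) {j : Fin 4} (hj : j ≠ 0) :
    pderiv i (fun y => u y j) x = pderiv i v x * x j + if i = j then v x else 0 := by
  rw [← pderiv_mul_coord (differentiableAt_of_contDiffOn hv hU hx)]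
  refine pderiv_congr hU hx (fun y hy => ?_) i
  obtain ⟨h1, h2, h3⟩ := hr y hy
  fin_cases j
  · exact absurd rfl hj
  · exact h1
  · exact h2
  · exact h3

/-- For a radial, irrotational, geodesic, unit field, the square of the velocity gradient and the
derivative of `v` in the direction orthogonal to the field, in terms of the expansion. -/
theorem IsRadialWith.gradSq_eq (hr : IsRadialWith U u v) (hgeo : IsGeodesic U u)
    (hun : IsUnitTimelike U u) (hU : IsOpen U) (hu : ContDiffOn ℝ ∞ u U)
    (hv : ContDiffOn ℝ ∞ v U) (hx : x ∈ U) (h0 : u x 0 ≠ 0)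
    (hax : x 1 ^ 2 + x 2 ^ 2 + x 3 ^ 2 ≠ 0)
    (hsymm : ∀ i j, eta j j * pderiv i (fun y => u y j) x
      = eta i i * pderiv j (fun y => u y i) x) :
    gradSq u x = 2 * v x ^ 2 + (expansion u x - 2 * v x) ^ 2 ∧
    (x 1 ^ 2 + x 2 ^ 2 + x 3 ^ 2) * v x * pderiv 0 v x
      + u x 0 * (x 1 * pderiv 1 v x + x 2 * pderiv 2 v x + x 3 * pderiv 3 v x)
      = u x 0 * (expansion u x - 3 * v x) := by
  have hp : ∀ i {j : Fin 4}, j ≠ 0 → pderiv i (fun y => u y j) x = _ :=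
    fun i _ hj => hr.pderiv_component hU hv hx i hj
  have p1 := fun i => hp i (j := 1) (by decide)
  have p2 := fun i => hp i (j := 2) (by decide)
  have p3 := fun i => hp i (j := 3) (by decide)
  obtain ⟨u1, u2, u3⟩ := hr x hx
  have s1 := hsymm 1 0
  have s2 := hsymm 2 0
  have s3 := hsymm 3 0
  have g0 := hgeo.sum_mul_pderiv hU hu hx 0
  have g1 := hgeo.sum_mul_pderiv hU hu hx 1
  have g2 := hgeo.sum_mul_pderiv hU hu hx 2
  have g3 := hgeo.sum_mul_pderiv hU hu hx 3
  have hn := hun x hx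
  simp only [gradSq, expansion, divergence, Fin.sum_univ_four, p1, p2, p3, u1, u2, u3, lower_zero,
    lower_one, lower_two, lower_three] at *
  simp [eta] at s1 s2 s3 g0 g1 g2 g3 ⊢
  generalize pderiv 0 (fun y => u y 0) x = c0 at *
  generalize pderiv 1 (fun y => u y 0) x = c1 at *
  generalize pderiv 2 (fun y => u y 0) x = c2 at *
  generalize pderiv 3 (fun y => u y 0) x = c3 at *
  generalize pderiv 0 v x = a0 at *
  generalize pderiv 1 v x = a1 at *
  generalize pderiv 2 v x = a2 at *
  generalize pderiv 3 v x = a3 at *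
  generalize u x 0 = C at *
  generalize v x = w at *
  generalize x 1 = y1 at *
  generalize x 2 = y2 at *
  generalize x 3 = y3 at *
  obtain rfl : c1 = -(a0 * y1) := by linarith
  obtain rfl : c2 = -(a0 * y2) := by linarith
  obtain rfl : c3 = -(a0 * y3) := by linarith
  -- The time component and the radial part of the geodesic equation. Together they say that the
  -- `(t, r)` block of `∇u` is singular, so its only possibly non-zero eigenvalue is its trace `θ -
  -- 2v`.
  have e0 : C * c0 = w * a0 * (y1 ^ 2 + y2 ^ 2 + y3 ^ 2) := by linear_combination g0
  have e1 : C * a0 + w * (y1 * a1 + y2 * a2 + y3 * a3) + w ^ 2 = 0 := by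
    refine (mul_eq_zero.1 (?_ : (y1 ^ 2 + y2 ^ 2 + y3 ^ 2) * _ = 0)).resolve_left hax
    linear_combination y1 * g1 + y2 * g2 + y3 * g3
  refine ⟨mul_left_cancel₀ h0 ?_, ?_⟩
  · linear_combination
      (-2 * (y1 * a1 + y2 * a2 + y3 * a3 + w)) * e0 + (-2 * a0 * (y1 ^ 2 + y2 ^ 2 + y3 ^ 2)) * e1
  · linear_combination -e0

/-- A radial geodesic unit field off the axis, with `θ` and the square of its gradient constant
in the directions orthogonal to it, has isotropic expansion. -/
theorem IsRadialWith.expansion_eq (hr : IsRadialWith U u v) (hgeo : IsGeodesic U u)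
    (hun : IsUnitTimelike U u) (hU : IsOpen U) (hu : ContDiffOn ℝ ∞ u U)
    (hv : ContDiffOn ℝ ∞ v U) (h0 : ∀ x ∈ U, u x 0 ≠ 0)
    (hax : ∀ x ∈ U, x 1 ^ 2 + x 2 ^ 2 + x 3 ^ 2 ≠ 0)
    (hsymm : ∀ x ∈ U, ∀ i j, eta j j * pderiv i (fun y => u y j) x
      = eta i i * pderiv j (fun y => u y i) x)
    (hf : ∀ x ∈ U, ∀ j, pderiv j (expansion u) x = f x * lower (u x) j)
    (hg : ∀ x ∈ U, ∀ j, pderiv j (gradSq u) x = g x * lower (u x) j) (hx : x ∈ U) :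
    expansion u x = 3 * v x := by
  have key := fun y hy => hr.gradSq_eq hgeo hun hU hu hv hy (h0 y hy) (hax y hy) (hsymm y hy)
  have hE := (key x hx).2
  have dv := differentiableAt_of_contDiffOn hv hU hx
  have dθ := differentiableAt_of_contDiffOn (contDiffOn_expansion hU hu) hU hx
  have hd : ∀ j, pderiv j (gradSq u) x = 4 * v x * pderiv j v x
      + 2 * (expansion u x - 2 * v x) * (pderiv j (expansion u) x - 2 * pderiv j v x) := by
    intro j
    rw [pderiv_congr hU hx (fun y hy => (key y hy).1) j,
      pderiv_add j ((dv.fun_pow 2).const_mul 2) ((dθ.fun_sub (dv.const_mul 2)).fun_pow 2),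
      pderiv_const_mul j _ (dv.fun_pow 2), pderiv_pow j 2 dv,
      pderiv_pow j 2 (dθ.fun_sub (dv.const_mul 2)), pderiv_sub j dθ (dv.const_mul 2),
      pderiv_const_mul j _ dv]
    norm_num
    ring
  obtain ⟨u1, u2, u3⟩ := hr x hx
  have k0 := hd 0
  have k1 := hd 1
  have k2 := hd 2
  have k3 := hd 3
  simp only [hf x hx, hg x hx, lower_zero, lower_one, lower_two, lower_three, u1, u2, u3]
    at k0 k1 k2 k3
  -- The vector `(r² v, u⁰ x¹, u⁰ x², u⁰ x³)` is orthogonal to `u`, so contracting with it removes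
  -- `f` and `g`. What remains is `(θ - 3v)` times the derivative of `v` computed in `hE`.
  have : u x 0 * (expansion u x - 3 * v x) ^ 2 = 0 := by
    linear_combination (1 / 4 : ℝ) * ((x 1 ^ 2 + x 2 ^ 2 + x 3 ^ 2) * v x * k0
      + u x 0 * (x 1 * k1 + x 2 * k2 + x 3 * k3)) - (expansion u x - 3 * v x) * hE
  have h2 := pow_eq_zero_iff (two_ne_zero) |>.1 ((mul_eq_zero.1 this).resolve_left (h0 x hx))
  linarith

/-- A geodesic, expanding, irrotational unit field of isotropic expansion about the axis satisfies
`∂ (u⁰ / θ) = dt / 3`. -/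
theorem pderiv_time_sub (hr : IsRadialWith U u fun x => expansion u x / 3)
    (hgeo : IsGeodesic U u) (hun : IsUnitTimelike U u) (hU : IsOpen U)
    (hu : ContDiffOn ℝ ∞ u U) (hθ : IsExpanding U u)
    (hsymm : ∀ x ∈ U, ∀ i j, eta j j * pderiv i (fun y => u y j) x
      = eta i i * pderiv j (fun y => u y i) x)
    (hf : ∀ x ∈ U, ∀ j, pderiv j (expansion u) x = -along u (expansion u) x * lower (u x) j)
    (hx : x ∈ U) (i : Fin 4) :
    pderiv i (fun y => y 0 - 3 * u y 0 / expansion u y) x = 0 := by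
  have cθ := contDiffOn_expansion hU hu
  have dθ := differentiableAt_of_contDiffOn cθ hU hx
  have du := differentiableAt_of_contDiffOn (contDiffOn_component hu 0) hU hx
  have hne := hθ x hx
  have cv : ContDiffOn ℝ ∞ (fun x => expansion u x / 3) U := cθ.div_const 3
  have hp : ∀ i {j : Fin 4}, j ≠ 0 → pderiv i (fun y => u y j) x = _ :=
    fun i _ hj => hr.pderiv_component hU cv hx i hj
  have hv3 : ∀ i, pderiv i (fun x => expansion u x / 3) x = pderiv i (expansion u) x / 3 := by
    intro i
    simp only [div_eq_inv_mul]
    rw [pderiv_const_mul i _ dθ]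
  simp only [hv3, hf x hx] at hp
  have hσ : along u (expansion u) x = -expansion u x ^ 2 / 3 := by
    obtain ⟨u1, u2, u3⟩ := hr x hx
    have p1 := fun i => hp i (j := 1) (by decide)
    have p2 := fun i => hp i (j := 2) (by decide)
    have p3 := fun i => hp i (j := 3) (by decide)
    have g1 := hgeo.sum_mul_pderiv hU hu hx 1
    have g2 := hgeo.sum_mul_pderiv hU hu hx 2
    have g3 := hgeo.sum_mul_pderiv hU hu hx 3
    have hn := hun x hx
    have hray := hgeo.along_expansion hU hu hx
    have g0 := hgeo.sum_mul_pderiv hU hu hx 0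
    have hexp : expansion u x = ∑ i, pderiv i (fun y => u y i) x := rfl
    simp only [gradSq, Fin.sum_univ_four, p1, p2, p3, u1, u2, u3, lower_zero,
      lower_one, lower_two, lower_three] at hray g0 g1 g2 g3 hn hexp
    simp at hray g0 g1 g2 g3 hexp
    -- On the axis the spatial geodesic equations are void. There the trace forces `∂_0 u⁰ = 0`, and
    -- Raychaudhuri's equation gives the value.
    by_cases hax : x 1 = 0 ∧ x 2 = 0 ∧ x 3 = 0
    · obtain ⟨y1, y2, y3⟩ := hax
      simp only [y1, y2, y3] at hray hexp
      have : pderiv 0 (fun y => u y 0) x = 0 := by linarith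
      rw [this] at hray
      rw [hray]; ring
    · have hfac : ∀ j : Fin 4, x j * (along u (expansion u) x + expansion u x ^ 2 / 3) = 0 →
          x j ≠ 0 → along u (expansion u) x = -expansion u x ^ 2 / 3 := by
        intro j h hj
        have := (mul_eq_zero.1 h).resolve_left hj
        linarith
      by_cases y1 : x 1 = 0
      · by_cases y2 : x 2 = 0
        · refine hfac 3 ?_ (fun y3 => hax ⟨y1, y2, y3⟩)
          linear_combination 3 * g3 + along u (expansion u) x * x 3 * hn
        · refine hfac 2 ?_ y2
          linear_combination 3 * g2 + along u (expansion u) x * x 2 * hn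
      · refine hfac 1 ?_ y1
        linear_combination 3 * g1 + along u (expansion u) x * x 1 * hn
  have hquot : pderiv i (fun y => y 0 - 3 * u y 0 / expansion u y) x * expansion u x ^ 2
      = (if i = 0 then 1 else 0) * expansion u x ^ 2
        - 3 * (pderiv i (fun y => u y 0) x * expansion u x
          - u x 0 * pderiv i (expansion u) x) := by
    have dq : DifferentiableAt ℝ (fun y => 3 * u y 0 / expansion u y) x := by
      simpa only [div_eq_mul_inv] using (du.const_mul 3).fun_mul (dθ.fun_inv hne)
    have h1 : pderiv i (fun y => (3 * u y 0 / expansion u y) * expansion u y) x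
        = pderiv i (fun y => 3 * u y 0) x :=
      pderiv_congr hU hx (fun y hy => div_mul_cancel₀ _ (hθ y hy)) i
    rw [pderiv_mul i dq dθ, pderiv_const_mul i _ du] at h1
    rw [pderiv_sub i (differentiableAt_coord 0) dq, pderiv_coord]
    field_simp at h1 ⊢
    linear_combination -h1
  refine (mul_eq_zero.1 (?_ : _ * expansion u x ^ 2 = 0)).resolve_right (pow_ne_zero 2 hne)
  rw [hquot, hf x hx, hσ]
  have hn := hun x hx
  obtain ⟨u1, u2, u3⟩ := hr x hx
  have hexp : expansion u x = ∑ i, pderiv i (fun y => u y i) x := rfl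
  -- Irrotationality trades `∂_i u⁰` for `-∂_0 u^i`, known from `u^i = θ x^i / 3`; for `i = 0` the
  -- trace identity `hexp` supplies `∂_0 u⁰` instead.
  have hs : eta 0 0 * pderiv i (fun y => u y 0) x = eta i i * pderiv 0 (fun y => u y i) x :=
    hsymm x hx i 0
  have p1 := fun i => hp i (j := 1) (by decide)
  have p2 := fun i => hp i (j := 2) (by decide)
  have p3 := fun i => hp i (j := 3) (by decide)
  simp only [Fin.sum_univ_four, p1, p2, p3, u1, u2, u3, lower_zero,
    lower_one, lower_two, lower_three, hσ] at hn hexp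
  simp at hexp
  fin_cases i
  · simp [lower_zero]
    linear_combination 3 * expansion u x * hexp + expansion u x ^ 2 * hn
  · simp [p1, eta, lower_zero, hσ] at hs
    simp [lower_one, u1]
    linear_combination -expansion u x * hs
  · simp [p2, eta, lower_zero, hσ] at hs
    simp [lower_two, u2]
    linear_combination -expansion u x * hs
  · simp [p3, eta, lower_zero, hσ] at hs
    simp [lower_three, u3]
    linear_combination -expansion u x * hs

end Radial

section IdealGas

/-! ### Classical ideal gas flows -/

variable {U : Set Event} {u : Event → Event} {φ : Event → ℝ} {x : Event}

theorem IsRadialUnit.time_eq (hφ : IsRadialUnit U u φ) (hx : x ∈ U) :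
    u x 0 = Real.cosh (φ x) := by
  simp [(hφ x hx).1, timeDir, radialDir]

theorem IsRadialUnit.space_eq (hφ : IsRadialUnit U u φ) (hx : x ∈ U) :
    IsRadialWith {x} u fun y => Real.sinh (φ y) / radius y := by
  rintro y rfl
  simp only [(hφ y hx).1, timeDir, radialDir]
  refine ⟨?_, ?_, ?_⟩ <;> simp <;> ring

theorem sq_radius (x : Event) : radius x ^ 2 = x 1 ^ 2 + x 2 ^ 2 + x 3 ^ 2 :=
  Real.sq_sqrt (by positivity)

theorem radius_eq_zero_iff : radius x = 0 ↔ x 1 = 0 ∧ x 2 = 0 ∧ x 3 = 0 := by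
  rw [← sq_eq_zero_iff, sq_radius]
  constructor
  · intro h
    refine ⟨?_, ?_, ?_⟩ <;> nlinarith [sq_nonneg (x 1), sq_nonneg (x 2), sq_nonneg (x 3)]
  · rintro ⟨h1, h2, h3⟩; simp [h1, h2, h3]

theorem IsRadialUnit.isUnitTimelike (hφ : IsRadialUnit U u φ) : IsUnitTimelike U u := by
  intro x hx
  obtain ⟨h1, h2, h3⟩ := hφ.space_eq hx x rfl
  have hc := Real.cosh_sq (φ x)
  simp only [Fin.sum_univ_four, lower_zero, lower_one, lower_two, lower_three, h1, h2, h3,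
    hφ.time_eq hx]
  by_cases hr : radius x = 0
  · have : Real.sinh (φ x) = 0 := by rw [(hφ x hx).2 hr]; simp
    rw [this] at hc ⊢
    linear_combination -hc
  · have h : Real.sinh (φ x) / radius x * radius x = Real.sinh (φ x) := div_mul_cancel₀ _ hr
    generalize Real.sinh (φ x) / radius x = w at *
    rw [← h] at hc
    linear_combination -hc - w ^ 2 * sq_radius x

/-- The velocity of a geodesic classical ideal gas, multiplied by its expansion, is a gradient. -/
theorem IsCIGFlow.exists_potential (hgas : IsCIGFlow U u) (hgeo : IsGeodesic U u)
    (hun : IsUnitTimelike U u) (hU : IsOpen U) (hu : ContDiffOn ℝ ∞ u U) :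
    ∃ f : Event → ℝ, ContDiffOn ℝ ∞ f U ∧
      ∀ x ∈ U, ∀ j, pderiv j f x = expansion u x * lower (u x) j := by
  obtain ⟨k, c, hk, hc, ρ, p, n, ε, s, Θ, h⟩ := hgas
  have hγ : k / c + 1 ≠ 0 := by positivity
  refine ⟨fun x => (k / c + 1)⁻¹ * Real.log (p x),
    contDiffOn_const.mul (h.smooth_p.log fun x hx => (h.p_pos x hx).ne'), fun x hx j => ?_⟩
  have dp := differentiableAt_of_contDiffOn h.smooth_p hU hx
  have dρ := differentiableAt_of_contDiffOn h.smooth_ρ hU hx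
  have dn := differentiableAt_of_contDiffOn h.smooth_n hU hx
  have du : DifferentiableAt ℝ u x := (hu.contDiffAt (hU.mem_nhds hx)).differentiableAt (by simp)
  have hp0 := h.p_pos x hx
  have hcons : ∀ j, (along u (fun y => ρ y + p y) x + (ρ x + p x) * expansion u x) * u x j
      + eta j j * pderiv j p x = 0 := by
    intro j
    have h1 := divergence_energyTensor du (dρ.fun_add dp) dp j
    have h2 := h.conservation x hx j
    rw [hgeo x hx] at h1
    simp only [energyTensor] at h2
    rw [h2] at h1
    simpa using h1.symm
  have hρp : along u (fun y => ρ y + p y) x = along u ρ x + along u p x := by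
    simp only [along, ← Finset.sum_add_distrib]
    refine Finset.sum_congr rfl fun i _ => ?_
    rw [pderiv_add i dρ dp]; ring
  -- Contraction of conservation with `u`. Once `u·∂p` is cancelled, this is the energy equation
  -- `u·∂ρ + (ρ + p) θ = 0`.
  have hM : along u (fun y => ρ y + p y) x + (ρ x + p x) * expansion u x = along u p x := by
    have hn := hun x hx
    have c0 := hcons 0
    have c1 := hcons 1
    have c2 := hcons 2
    have c3 := hcons 3
    generalize along u (fun y => ρ y + p y) x + (ρ x + p x) * expansion u x = M at *
    simp only [along, Fin.sum_univ_four] at *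
    simp [eta] at c0 c1 c2 c3
    simp only [lower_zero, lower_one, lower_two, lower_three] at hn
    linear_combination -(-u x 0) * c0 - u x 1 * c1 - u x 2 * c2 - u x 3 * c3 + M * hn
  have hmat : along u n x + n x * expansion u x = 0 := by
    have h1 := h.matter x hx
    rw [← h1]
    simp only [divergence, along, expansion, Finset.mul_sum, ← Finset.sum_add_distrib,
      Pi.smul_apply, smul_eq_mul]
    refine Finset.sum_congr rfl fun i _ => ?_
    rw [pderiv_mul i dn (differentiableAt_pi.1 du i)]; ring
  -- The equations of state combine into a barotropic-like relation linear in `ρ - n`, so the energy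
  -- and matter equations determine `u·∂p`.
  have hpρ : ∀ y ∈ U, p y = k / c * (ρ y - n y) := by
    intro y hy
    rw [h.p_eq y hy, h.energy_eq y hy, h.ε_eq y hy]
    field_simp
    ring
  have hup : along u p x = k / c * (along u ρ x - along u n x) := by
    simp only [along, ← Finset.sum_sub_distrib, Finset.mul_sum]
    refine Finset.sum_congr rfl fun i _ => ?_
    rw [pderiv_congr hU hx hpρ i, pderiv_const_mul i _ (dρ.fun_sub dn), pderiv_sub i dρ dn]
    ring
  have hlog : pderiv j (fun y => Real.log (p y)) x = pderiv j p x / p x := by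
    have : fderiv ℝ (fun y => Real.log (p y)) x = _ := (dp.hasFDerivAt.log hp0.ne').fderiv
    simp [pderiv, this, div_eq_inv_mul]
  have dlog : DifferentiableAt ℝ (fun y => Real.log (p y)) x := dp.log hp0.ne'
  have hval : along u p x = -(k / c + 1) * p x * expansion u x := by
    have e := hpρ x hx
    linear_combination hup + k / c * hM - k / c * hmat - k / c * hρp + expansion u x * e
  have hj := hcons j
  rw [hM, hval] at hj
  have hpj : pderiv j p x = (k / c + 1) * p x * expansion u x * lower (u x) j := by
    rw [lower]
    linear_combination eta j j * hj - pderiv j p x * eta_self_sq j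
  rw [pderiv_const_mul j _ dlog, hlog, hpj]
  field_simp

/-! ### From the gas to the Milne congruence -/

theorem isOpen_offAxis : IsOpen {x : Event | x 1 ^ 2 + x 2 ^ 2 + x 3 ^ 2 ≠ 0} :=
  isOpen_ne_fun (by fun_prop) (by fun_prop)

theorem IsUnitTimelike.mono {V : Set Event} (h : IsUnitTimelike U u) (hV : V ⊆ U) :
    IsUnitTimelike V u := fun x hx => h x (hV hx)

theorem isMilne_of_isCIGFlow (hU : IsOpen U) (hUc : IsConnected U) (hu : ContDiffOn ℝ ∞ u U)
    (hφ : IsRadialUnit U u φ) (hgeo : IsGeodesic U u) (hθ : IsExpanding U u)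
    (hgas : IsCIGFlow U u) : IsMilne U φ := by
  have hun := hφ.isUnitTimelike
  have cθ := contDiffOn_expansion hU hu
  obtain ⟨f, cf, hf⟩ := hgas.exists_potential hgeo hun hU hu
  have hsymm : ∀ x ∈ U, ∀ i j, eta j j * pderiv i (fun y => u y j) x
      = eta i i * pderiv j (fun y => u y i) x := fun x hx =>
    hgeo.pderiv_lower_symm hun hU hu cf cθ hf hx (hθ x hx)
  have hdθ : ∀ x ∈ U, ∀ j, pderiv j (expansion u) x = -along u (expansion u) x * lower (u x) j :=
    fun x hx => hgeo.pderiv_eq_of_gradient hun hU hu cf cθ hf hx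
  have hdθ' : ∀ x ∈ U, ∀ j, pderiv j (expansion u) x = gradSq u x * lower (u x) j := by
    intro x hx j
    rw [hdθ x hx, hgeo.along_expansion hU hu hx, neg_neg]
  have hdω : ∀ x ∈ U, ∀ j, pderiv j (gradSq u) x = -along u (gradSq u) x * lower (u x) j :=
    fun x hx => hgeo.pderiv_eq_of_gradient hun hU hu cθ (contDiffOn_gradSq hU hu) hdθ' hx
  have h0 : ∀ x ∈ U, u x 0 ≠ 0 := fun x hx => by
    rw [hφ.time_eq hx]; exact (Real.cosh_pos _).ne'
  -- The factor `θ / 3` is smooth across the axis, where the ratio `sinh φ / r` has no evident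
  -- smooth extension.
  have hr : IsRadialWith U u fun x => expansion u x / 3 := by
    intro x hx
    by_cases hax : x 1 ^ 2 + x 2 ^ 2 + x 3 ^ 2 = 0
    · have hrad : radius x = 0 := by rw [← sq_eq_zero_iff, sq_radius, hax]
      obtain ⟨h1, h2, h3⟩ := radius_eq_zero_iff.1 hrad
      obtain ⟨k1, k2, k3⟩ := hφ.space_eq hx x rfl
      simp [k1, k2, k3, h1, h2, h3]
    · set V := U ∩ {x : Event | x 1 ^ 2 + x 2 ^ 2 + x 3 ^ 2 ≠ 0} with hV
      have hVU : V ⊆ U := Set.inter_subset_left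
      -- This equals `sinh φ / r` off the axis, but is built from `u` alone, so its smoothness needs
      -- no regularity of `φ`.
      set v : Event → ℝ := fun y =>
        (u y 1 * y 1 + u y 2 * y 2 + u y 3 * y 3) / (y 1 ^ 2 + y 2 ^ 2 + y 3 ^ 2) with hv
      have hrv : IsRadialWith V u v := by
        rintro y ⟨hy, hya⟩
        obtain ⟨k1, k2, k3⟩ := hφ.space_eq hy y rfl
        have : v y = Real.sinh (φ y) / radius y := by
          simp only [hv]
          rw [div_eq_iff hya, k1, k2, k3]
          ring
        simp only [this, k1, k2, k3, and_self]
      have cu := fun j => contDiffOn_component (hu.mono hVU) j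
      have cx : ∀ j : Fin 4, ContDiffOn ℝ ∞ (fun y : Event => y j) V := fun j =>
        (contDiff_apply ℝ ℝ j).contDiffOn
      have cv : ContDiffOn ℝ ∞ v V :=
        ((((cu 1).mul (cx 1)).add ((cu 2).mul (cx 2))).add ((cu 3).mul (cx 3))).div
          ((((cx 1).pow 2).add ((cx 2).pow 2)).add ((cx 3).pow 2)) fun y hy => hy.2
      have hxV : x ∈ V := ⟨hx, hax⟩
      have he : expansion u x = 3 * v x :=
        hrv.expansion_eq (fun y hy => hgeo y (hVU hy)) (hun.mono hVU) (hU.inter isOpen_offAxis)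
          (hu.mono hVU) cv (fun y hy => h0 y (hVU hy)) (fun y hy => hy.2)
          (fun y hy => hsymm y (hVU hy)) (fun y hy => hdθ y (hVU hy))
          (fun y hy => hdω y (hVU hy)) hxV
      have : expansion u x / 3 = v x := by rw [he]; ring
      simp only [this]
      exact hrv x hxV
  have hconst := fun x (hx : x ∈ U) => fderiv_eq_zero_of_pderiv
    (pderiv_time_sub hr hgeo hun hU hu hθ hsymm hdθ hx)
  obtain ⟨t₀, ht⟩ := hU.exists_is_const_of_fderiv_eq_zero hUc.isPreconnected
    (f := fun y => y 0 - 3 * u y 0 / expansion u y)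
    (fun x hx => (differentiableAt_of_contDiffOn
      ((contDiff_apply ℝ ℝ (0 : Fin 4)).contDiffOn.sub
        ((contDiffOn_const.mul (contDiffOn_component hu 0)).div cθ hθ)) hU
        hx).differentiableWithinAt) hconst
  refine ⟨t₀, fun x hx => ?_⟩
  have hθx := hθ x hx
  have hC := Real.cosh_pos (φ x)
  have h1 : x 0 - t₀ = 3 * Real.cosh (φ x) / expansion u x := by
    have := ht x hx
    simp only [hφ.time_eq hx] at this
    linarith
  have h2 : x 0 - t₀ ≠ 0 := by
    rw [h1]; positivity
  refine ⟨sub_ne_zero.1 h2, ?_⟩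
  by_cases hrad : radius x = 0
  · rw [hrad, (hφ x hx).2 hrad]; simp
  have h3 : Real.sinh (φ x) / radius x = expansion u x / 3 := by
    obtain ⟨k1, k2, k3⟩ := hφ.space_eq hx x rfl
    obtain ⟨l1, l2, l3⟩ := hr x hx
    rw [k1] at l1
    rw [k2] at l2
    rw [k3] at l3
    by_contra hne
    refine hrad (radius_eq_zero_iff.2 ⟨?_, ?_, ?_⟩) <;> by_contra hj
    · exact hne (mul_right_cancel₀ hj l1)
    · exact hne (mul_right_cancel₀ hj l2)
    · exact hne (mul_right_cancel₀ hj l3)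
  rw [h1, Real.tanh_eq_sinh_div_cosh, (div_eq_iff hrad).1 h3]
  field_simp

end IdealGas

section Milne

/-! ### Milne congruences -/

variable {U : Set Event} {u : Event → Event} {φ : Event → ℝ} {x : Event}

/-- If a unit field is `v` times the position relative to an event on the axis, then the gradient
of `v` is `v² u`. -/
theorem IsRadialWith.pderiv_of_central {v : Event → ℝ} {t₀ : ℝ} (hr : IsRadialWith U u v)
    (ht : ∀ y ∈ U, u y 0 = v y * (y 0 - t₀)) (hun : IsUnitTimelike U u) (hU : IsOpen U)
    (hv : ContDiffOn ℝ ∞ v U) (hv0 : ∀ y ∈ U, v y ≠ 0) (hx : x ∈ U) (i : Fin 4) :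
    pderiv i v x = v x ^ 2 * lower (u x) i := by
  have dv := differentiableAt_of_contDiffOn hv hU hx
  have dx : ∀ j : Fin 4, DifferentiableAt ℝ (fun y : Event => y j) x := differentiableAt_coord
  have dT : DifferentiableAt ℝ (fun y : Event => y 0 - t₀) x :=
    (dx 0).fun_sub (differentiableAt_const _)
  -- Unit norm reads `v² τ² = 1`. Its derivative times `v / 2` gives `∂_i v` as `v³` times the
  -- lowered relative position, without any division.
  have hQ : ∀ y ∈ U, v y ^ 2 * ((y 0 - t₀) ^ 2 - (y 1 ^ 2 + y 2 ^ 2 + y 3 ^ 2)) = 1 := by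
    intro y hy
    have hn := hun y hy
    obtain ⟨h1, h2, h3⟩ := hr y hy
    simp only [Fin.sum_univ_four, lower_zero, lower_one, lower_two, lower_three, h1, h2, h3,
      ht y hy] at hn
    linear_combination -hn
  have d3 := (((dx 1).fun_pow 2).fun_add ((dx 2).fun_pow 2)).fun_add ((dx 3).fun_pow 2)
  have h := pderiv_congr hU hx hQ i
  rw [pderiv_const, pderiv_mul i (dv.fun_pow 2) ((dT.fun_pow 2).fun_sub d3), pderiv_pow i 2 dv,
    pderiv_sub i (dT.fun_pow 2) d3, pderiv_pow i 2 dT,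
    pderiv_sub i (dx 0) (differentiableAt_const _),
    pderiv_add i (((dx 1).fun_pow 2).fun_add ((dx 2).fun_pow 2)) ((dx 3).fun_pow 2),
    pderiv_add i ((dx 1).fun_pow 2) ((dx 2).fun_pow 2), pderiv_pow i 2 (dx 1),
    pderiv_pow i 2 (dx 2), pderiv_pow i 2 (dx 3), pderiv_const] at h
  simp only [pderiv_coord] at h
  have hQx := hQ x hx
  obtain ⟨h1, h2, h3⟩ := hr x hx
  have hv0x := hv0 x hx
  have hlow : pderiv i v x = v x ^ 3 *
      (if i = 0 then -(x 0 - t₀) else x i) := by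
    fin_cases i <;> simp at h ⊢ <;> linear_combination (v x / 2) * h - pderiv _ v x * hQx
  rw [hlow]
  fin_cases i
  · simp [lower_zero, ht x hx]; ring
  · simp [lower_one, h1]; ring
  · simp [lower_two, h2]; ring
  · simp [lower_three, h3]; ring

theorem IsMilne.isCIGFlow (hU : IsOpen U) (hUc : IsConnected U) (hu : ContDiffOn ℝ ∞ u U)
    (hφ : IsRadialUnit U u φ) (hM : IsMilne U φ) :
    IsGeodesic U u ∧ IsExpanding U u ∧ IsCIGFlow U u := by
  obtain ⟨t₀, hM⟩ := hM
  have hun := hφ.isUnitTimelike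
  have hT : ∀ y ∈ U, y 0 - t₀ ≠ 0 := fun y hy => sub_ne_zero.2 (hM y hy).1
  set v : Event → ℝ := fun y => u y 0 / (y 0 - t₀) with hv
  have cv : ContDiffOn ℝ ∞ v U := (contDiffOn_component hu 0).div
    ((contDiff_apply ℝ ℝ (0 : Fin 4)).contDiffOn.sub contDiffOn_const) hT
  have ht : ∀ y ∈ U, u y 0 = v y * (y 0 - t₀) := fun y hy => (div_mul_cancel₀ _ (hT y hy)).symm
  have hv0 : ∀ y ∈ U, v y ≠ 0 := fun y hy => div_ne_zero
    (by rw [hφ.time_eq hy]; exact (Real.cosh_pos _).ne') (hT y hy)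
  have hr : IsRadialWith U u v := by
    intro y hy
    obtain ⟨h1, h2, h3⟩ := hφ.space_eq hy y rfl
    by_cases hrad : radius y = 0
    · obtain ⟨k1, k2, k3⟩ := radius_eq_zero_iff.1 hrad
      simp [h1, h2, h3, k1, k2, k3]
    have : v y = Real.sinh (φ y) / radius y := by
      have h := (hM y hy).2
      have hTy := hT y hy
      have hc := (Real.cosh_pos (φ y)).ne'
      rw [Real.tanh_eq_sinh_div_cosh, div_eq_div_iff hc hTy] at h
      simp only [hv, hφ.time_eq hy]
      rw [div_eq_div_iff hTy hrad]
      linear_combination -h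
    simp only [this, h1, h2, h3, and_self]
  have hdv : ∀ x ∈ U, ∀ i, pderiv i v x = v x ^ 2 * lower (u x) i := fun x hx =>
    hr.pderiv_of_central ht hun hU cv hv0 hx
  have hdu : ∀ x ∈ U, ∀ i j, pderiv i (fun y => u y j) x
      = v x * lower (u x) i * u x j + if i = j then v x else 0 := by
    intro x hx i j
    by_cases hj : j = 0
    · subst hj
      have dv := differentiableAt_of_contDiffOn cv hU hx
      rw [pderiv_congr hU hx ht i, pderiv_mul i dv
        ((differentiableAt_coord 0).fun_sub (differentiableAt_const _)),
        pderiv_sub i (differentiableAt_coord 0) (differentiableAt_const _), pderiv_const,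
        pderiv_coord, hdv x hx, ht x hx]
      split_ifs <;> ring
    · rw [hr.pderiv_component hU cv hx i hj, hdv x hx]
      obtain ⟨h1, h2, h3⟩ := hr x hx
      have : u x j = v x * x j := by fin_cases j <;> first | exact absurd rfl hj | assumption
      rw [this]
      ring
  have hgeo : IsGeodesic U u := by
    intro x hx
    funext j
    have hn := hun x hx
    rw [acceleration_apply ((hu.contDiffAt (hU.mem_nhds hx)).differentiableAt (by simp))]
    simp only [hdu x hx, mul_add, Finset.sum_add_distrib, mul_ite, mul_zero,
      Finset.sum_ite_eq', Finset.mem_univ, if_true]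
    have : ∑ i, u x i * (v x * lower (u x) i * u x j)
        = v x * u x j * ∑ i, lower (u x) i * u x i := by
      rw [Finset.mul_sum]; exact Finset.sum_congr rfl fun i _ => by ring
    rw [this, hn]
    simp
    ring
  have hexp : ∀ x ∈ U, expansion u x = 3 * v x := by
    intro x hx
    have hn := hun x hx
    simp only [expansion, divergence, hdu x hx, if_true, Fin.sum_univ_four] at hn ⊢
    linear_combination v x * hn
  refine ⟨hgeo, fun x hx => ?_, ?_⟩
  · rw [hexp x hx]; exact mul_ne_zero three_ne_zero (hv0 x hx)
  -- The sign of `v` is constant by connectedness: negative means a contracting congruence, before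
  -- `t₀`.
  obtain ⟨σ, hσ, hσv⟩ : ∃ σ : ℝ, σ ^ 2 = 1 ∧ ∀ x ∈ U, 0 < σ * v x := by
    obtain ⟨x₀, hx₀⟩ := hUc.nonempty
    have hsign : ∀ a b : Event, a ∈ U → b ∈ U → v a < 0 → ¬ 0 < v b := by
      intro a b ha hb hva hvb
      obtain ⟨y, hy, hy0⟩ := hUc.isPreconnected.intermediate_value ha hb cv.continuousOn
        (Set.mem_Icc.2 ⟨hva.le, hvb.le⟩)
      exact hv0 y hy hy0
    rcases lt_or_gt_of_ne (hv0 x₀ hx₀) with h | h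
    · refine ⟨-1, by norm_num, fun x hx => ?_⟩
      rcases lt_or_gt_of_ne (hv0 x hx) with h' | h'
      · linarith
      · exact absurd h' (hsign x₀ x hx₀ hx h)
    · refine ⟨1, by norm_num, fun x hx => ?_⟩
      rcases lt_or_gt_of_ne (hv0 x hx) with h' | h'
      · exact absurd h (hsign x x₀ hx hx₀ h')
      · linarith
  set m : Event → ℝ := fun x => σ * v x with hm
  have cm : ContDiffOn ℝ ∞ m U := contDiffOn_const.mul cv
  have hvm : ∀ x, v x = σ * m x := fun x => by
    simp only [hm]; linear_combination -v x * hσ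
  have hdm : ∀ x ∈ U, ∀ i, pderiv i m x = σ * m x ^ 2 * lower (u x) i := by
    intro x hx i
    rw [pderiv_const_mul i _ (differentiableAt_of_contDiffOn cv hU hx), hdv x hx, hvm]
    linear_combination σ * m x ^ 2 * lower (u x) i * hσ
  have ham : ∀ x ∈ U, along u m x = -σ * m x ^ 2 := by
    intro x hx
    have hn := hun x hx
    simp only [along, hdm x hx, Fin.sum_univ_four] at hn ⊢
    linear_combination σ * m x ^ 2 * hn
  -- With `m = 1/|τ|`, matter conservation suggests `n = m³`. Taking `k = 1`, `c_v = 3` gives `γ =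
  -- 4/3`, so `p = m⁴` is adiabatic: `3 dm + m⁴ d(m⁻³) = 0`, allowing constant entropy.
  refine ⟨1, 3, one_pos, three_pos, fun x => m x ^ 3 + 3 * m x ^ 4, fun x => m x ^ 4,
    fun x => m x ^ 3, fun x => 3 * m x, fun _ => 0, m, ?_⟩
  have along_pow : ∀ x ∈ U, ∀ l : ℕ, along u (fun y => m y ^ l) x
      = l * m x ^ (l - 1) * along u m x := by
    intro x hx l
    simp only [along, pderiv_pow _ l (differentiableAt_of_contDiffOn cm hU hx), Finset.mul_sum]
    exact Finset.sum_congr rfl fun i _ => by ring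
  refine ⟨(cm.pow 3).add (contDiffOn_const.mul (cm.pow 4)), cm.pow 4, cm.pow 3,
    contDiffOn_const.mul cm, contDiffOn_const, cm, ?_, fun x hx => pow_pos (hσv x hx) 3,
    fun x _ => by ring, ?_, ?_, fun x _ => by ring, fun x hx => pow_pos (hσv x hx) 4,
    fun x _ => rfl⟩
  · intro x hx j
    have du : DifferentiableAt ℝ u x := (hu.contDiffAt (hU.mem_nhds hx)).differentiableAt (by simp)
    have dm := differentiableAt_of_contDiffOn cm hU hx
    have dF : DifferentiableAt ℝ (fun y => m y ^ 3 + 3 * m y ^ 4 + m y ^ 4) x :=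
      ((dm.fun_pow 3).fun_add ((dm.fun_pow 4).const_mul 3)).fun_add (dm.fun_pow 4)
    have h := divergence_energyTensor du dF (dm.fun_pow 4) j
    refine h.trans ?_
    have hF : along u (fun y => m y ^ 3 + 3 * m y ^ 4 + m y ^ 4) x
        = (3 * m x ^ 2 + 16 * m x ^ 3) * along u m x := by
      simp only [along, Finset.mul_sum]
      refine Finset.sum_congr rfl fun i _ => ?_
      rw [pderiv_add i ((dm.fun_pow 3).fun_add ((dm.fun_pow 4).const_mul 3)) (dm.fun_pow 4),
        pderiv_add i (dm.fun_pow 3) ((dm.fun_pow 4).const_mul 3),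
        pderiv_const_mul i _ (dm.fun_pow 4), pderiv_pow i 3 dm, pderiv_pow i 4 dm]
      norm_num
      ring
    rw [hF, ham x hx, hexp x hx, hgeo x hx, pderiv_pow j 4 dm, hdm x hx, hvm, lower]
    norm_num
    linear_combination 4 * m x ^ 5 * σ * u x j * eta_self_sq j
  · intro x hx
    have du : DifferentiableAt ℝ u x := (hu.contDiffAt (hU.mem_nhds hx)).differentiableAt (by simp)
    have dm := differentiableAt_of_contDiffOn cm hU hx
    have : divergence (fun y => m y ^ 3 • u y) x
        = along u (fun y => m y ^ 3) x + m x ^ 3 * expansion u x := by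
      simp only [divergence, along, expansion, Finset.mul_sum, ← Finset.sum_add_distrib,
        Pi.smul_apply, smul_eq_mul]
      refine Finset.sum_congr rfl fun i _ => ?_
      rw [pderiv_mul i (dm.fun_pow 3) (differentiableAt_pi.1 du i)]; ring
    rw [this, along_pow x hx, ham x hx, hexp x hx, hvm]
    norm_num
    ring
  · intro x hx
    have hmx : m x ≠ 0 := (hσv x hx).ne'
    have dm := differentiableAt_of_contDiffOn cm hU hx
    have h1 : HasFDerivAt (fun y => 1 / m y ^ 3)
        ((-3 / m x ^ 4) • fderiv ℝ m x) x := by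
      have h2 : HasDerivAt (fun z : ℝ => 1 / z ^ 3) (-3 / m x ^ 4) (m x) := by
        have := (hasDerivAt_pow 3 (m x)).fun_inv (pow_ne_zero 3 hmx)
        simp only [one_div]
        refine this.congr_deriv ?_
        rw [div_eq_div_iff (pow_ne_zero 2 (pow_ne_zero 3 hmx)) (pow_ne_zero 4 hmx)]
        push_cast
        ring
      exact h2.comp_hasFDerivAt x dm.hasFDerivAt
    rw [h1.fderiv, fderiv_const_mul dm 3, smul_smul, ← add_smul]
    have : (3 : ℝ) + m x ^ 4 * (-3 / m x ^ 4) = 0 := by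
      field_simp
      ring
    simp [this]

end Milne

end Minkowski

theorem mainTheorem12 (U : Set Minkowski.Event) (hU : IsOpen U) (hUc : IsConnected U)
    (u : Minkowski.Event → Minkowski.Event) (hu : ContDiffOn ℝ ∞ u U)
    (φ : Minkowski.Event → ℝ) (hφ : Minkowski.IsRadialUnit U u φ) :
    (Minkowski.IsGeodesic U u ∧ Minkowski.IsExpanding U u ∧ Minkowski.IsCIGFlow U u) ↔
      Minkowski.IsMilne U φ :=
  ⟨fun h => Minkowski.isMilne_of_isCIGFlow hU hUc hu hφ h.1 h.2.1 h.2.2,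
    fun h => h.isCIGFlow hU hUc hu hφ⟩
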